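/- Let $1<p<\infty$ and $$C_p=\frac{p}{4(p-1)^{1/p}\,B(1/p',1/p)},\qquad B(1/p',1/p)=\int_0^1 t^{-1/p}(1-t)^{1/p-1}\,dt,\qquad \frac1p+\frac1{p'}=1 .$$ Let $X$ be either $\ell^p(\mathbb{R}^n)$, that is $\mathbb{R}^n$ with the norm $\|x\|=\bigl(\sum_{j=1}^n|x_j|^p\bigr)^{1/p}$, or the real Lebesgue space $L^p(M,\mu)$ of an arbitrary measure space $(M,\mu)$. Let $f:X\to X$ be Lipschitz continuous with constant $L$, and let $x:\mathbb{R}\to X$ be a non-constant $T$-periodic solution, $T>0$, of $\dot x=f(x)$. Then $$TL\ge C_p^{-1}.$$ Moreover $C_p^{-1}>6$ whenever $1.43\le p\le 3.35$, so that $TL>6$ for these $p$. -/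

import Mathlib

open MeasureTheory
open scoped ENNReal NNReal

/-- The constant `C_p = p / (4 (p - 1)^{1/p} ∫₀¹ t^{-1/p} (1 - t)^{1/p - 1} dt)`, for a real
exponent `1 < p`. The integral is the beta function `B(1/p', 1/p)`, with `p'` the Hölder
conjugate of `p`. -/
noncomputable def wirtingerConst (p : ℝ) : ℝ :=
  p / (4 * (p - 1) ^ (1 / p) * ∫ t in (0 : ℝ)..1, t ^ (-(1 / p)) * (1 - t) ^ (1 / p - 1))

/-- `x : ℝ → X` is a non-constant `T`-periodic solution (with `T > 0`) of `ẋ = f(x)`. -/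
structure IsNonconstantPeriodicSolution {X : Type*} [NormedAddCommGroup X] [NormedSpace ℝ X]
    (f : X → X) (x : ℝ → X) (T : ℝ) : Prop where
  period_pos : 0 < T
  hasDerivAt : ∀ t : ℝ, HasDerivAt x (f (x t)) t
  periodic : Function.Periodic x T
  nonconstant : ∃ s t : ℝ, x s ≠ x t

/-!
Suppose `T * L < C_p⁻¹`. The curve `y t = x (t + T / 2) - x t` is antiperiodic with half-period
`T / 2`, and `‖y'‖ ≤ L ‖y‖` because both of its terms solve the equation. A real antiperiodic
function vanishes somewhere, so the sharp Poincaré inequality for functions on an interval of length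
`T / 2` that vanish at both ends applies to each coordinate (or to almost every point of the measure
space) and gives `‖y‖_p ≤ C_p T ‖y'‖_p` on a half-period; hence `y = 0`, that is, `T / 2` is a period
as well (`periodic_half_of_mul_lt`). By iteration `x` has the periods `T / 2 ^ k` for all `k`, so
`x' = 0` and `x` is constant (`inv_wirtingerConst_le_period_mul`).

The Poincaré inequality is used in a discrete form, for the values of `y` on the mesh
`h = T / (4 m)`. This avoids measurability and Fubini questions in `L^p` over an arbitrary measure
space: only finite sums of elements of `L^p` occur. Grönwall's inequality bounds the difference
`y (t + h) - y t` by `L h exp (L h) ‖y t‖`, and the constants become sharp as `m → ∞`.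

The discrete inequality is proved by Picone's method: if `Q ≥ 0` solves the Riccati inequality
`c + (p - 1) Q_j ^ q ≤ Q_j - Q_{j+1}`, with `q` the conjugate exponent, then Young's inequality
makes `∑ |u_{j+1} - u_j| ^ p - c ∑ |u_{j+1}| ^ p` dominate a telescoping sum
(`sum_rpow_le_of_riccati`). Such a `Q` lives as long as the solution of `v' = 1 + v ^ q`, whose
lifetime is `∫₀^∞ ds / (1 + s ^ q)`; the substitution `t = s ^ q / (1 + s ^ q)` identifies it with
`q⁻¹ B(1/p', 1/p)`, and this is where `C_p` comes from.

For the numerical part put `a = 1 / p`. By the reflection formula,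
`C_p⁻¹ = 4 π a ^ (1 - a) (1 - a) ^ a / sin (π a)`, which is invariant under `a ↦ 1 - a` and
increasing on `[20/67, 1/2]`, so that it suffices to evaluate it at `a = 20/67`, i.e. `p = 3.35`.
-/

/-! ### A sharp Wirtinger inequality for antiperiodic real sequences -/

/-- One step of the discrete Picone inequality: convexity of `x ↦ x ^ p` bounds `a ^ p - b ^ p` by
`p * a ^ (p - 1) * d`, and Young's inequality splits the product `d * (Q * a ^ (p - 1))`. -/
theorem mul_rpow_le_picone {p q : ℝ} (hpq : p.HolderConjugate q) {Q a b d : ℝ} (hQ : 0 ≤ Q)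
    (ha : 0 ≤ a) (hb : 0 ≤ b) (hd : |a - b| ≤ d) :
    Q * a ^ p ≤ Q * b ^ p + d ^ p + (p - 1) * Q ^ q * a ^ p := by
  have hp := hpq.lt
  have hp0 := hpq.pos
  have hd0 : 0 ≤ d := (abs_nonneg _).trans hd
  have hq : p / q = p - 1 := by
    rw [hpq.conjugate_eq]; field_simp
  have hpow : ∀ x : ℝ, 0 ≤ x → (x ^ (p - 1)) ^ q = x ^ p := fun x hx => by
    rw [← Real.rpow_mul hx, hpq.sub_one_mul_conj]
  have hmul : a * a ^ (p - 1) = a ^ p := by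
    rcases ha.eq_or_lt with rfl | h
    · rw [zero_mul, Real.zero_rpow hp0.ne']
    · rw [← Real.rpow_one_add' ha (by linarith)]; congr 1; ring
  have young : ∀ x y : ℝ, 0 ≤ x → 0 ≤ y → p * (x * y) ≤ x ^ p + (p - 1) * y ^ q := by
    intro x y hx hy
    have := mul_le_mul_of_nonneg_left (Real.young_inequality_of_nonneg hx hy hpq) hp0.le
    rw [← hq]
    calc _ ≤ _ := this
      _ = _ := by field_simp
  -- convexity of `x ↦ x ^ p`: the tangent at `a` lies below the graph at `b`
  have h1 := young b (a ^ (p - 1)) hb (by positivity)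
  rw [hpow a ha] at h1
  have h2 := young d (Q * a ^ (p - 1)) hd0 (by positivity)
  rw [Real.mul_rpow hQ (by positivity), hpow a ha] at h2
  have h3 : a - b ≤ d := (le_abs_self _).trans hd
  have h4 : a ^ p ≤ b ^ p + p * (d * a ^ (p - 1)) := by
    have := mul_le_mul_of_nonneg_right h3 (Real.rpow_nonneg ha (p - 1))
    nlinarith
  nlinarith [mul_le_mul_of_nonneg_left h4 hQ]

/-- A discrete Poincaré inequality for sequences starting at `0`, from a nonnegative solution `Q` of a
discrete Riccati inequality. The sums telescope with the extra term `Q n * |u n| ^ p`. -/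
theorem sum_rpow_le_of_riccati {p q : ℝ} (hpq : p.HolderConjugate q) {c : ℝ} {Q u : ℕ → ℝ}
    {m : ℕ} (hQ : ∀ j, 0 ≤ Q j) (hric : ∀ j < m, c + (p - 1) * Q j ^ q ≤ Q j - Q (j + 1))
    (hu : u 0 = 0) :
    c * ∑ j ∈ Finset.range m, |u (j + 1)| ^ p
      ≤ ∑ j ∈ Finset.range m, |u (j + 1) - u j| ^ p := by
  have key : ∀ n ≤ m, c * ∑ j ∈ Finset.range n, |u (j + 1)| ^ p + Q n * |u n| ^ p
      ≤ ∑ j ∈ Finset.range n, |u (j + 1) - u j| ^ p := by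
    intro n
    induction n with
    | zero => simp [hu, Real.zero_rpow hpq.pos.ne']
    | succ n ih =>
      intro hn
      have h1 := ih (by omega)
      have h2 := mul_rpow_le_picone hpq (hQ n) (abs_nonneg (u (n + 1))) (abs_nonneg (u n))
        (abs_abs_sub_abs_le_abs_sub _ _)
      have h3 := mul_le_mul_of_nonneg_right (hric n (by omega))
        (Real.rpow_nonneg (abs_nonneg (u (n + 1))) p)
      rw [Finset.sum_range_succ, Finset.sum_range_succ]
      nlinarith
  have := key m le_rfl
  have h2 : 0 ≤ Q m * |u m| ^ p := mul_nonneg (hQ m) (by positivity)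
  linarith

theorem sum_range_add_eq_of_periodic {g : ℕ → ℝ} {N : ℕ} (hg : ∀ j, g (j + N) = g j) (k : ℕ) :
    ∑ j ∈ Finset.range N, g (k + j) = ∑ j ∈ Finset.range N, g j := by
  induction k with
  | zero => simp
  | succ k ih =>
    have h1 := Finset.sum_range_succ (fun j => g (k + j)) N
    have h2 := Finset.sum_range_succ' (fun j => g (k + j)) N
    simp only [hg, add_zero] at h1 h2
    rw [← ih]
    have : ∀ j, g (k + 1 + j) = g (k + (j + 1)) := fun j => by congr 1; ring
    simp only [this]
    linarith

theorem exists_mul_succ_nonpos_of_antiperiodic {u : ℕ → ℝ} {N : ℕ}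
    (hu : ∀ j, u (j + N) = -u j) : ∃ k, u k * u (k + 1) ≤ 0 := by
  by_contra! h
  have h0 : ∀ n, 0 < u 0 * u n := by
    intro n
    induction n with
    | zero => exact mul_self_pos.2 fun h1 => by simpa [h1] using h 0
    | succ n ih =>
      have h2 : 0 < u n ^ 2 := by
        have : u n ≠ 0 := fun h1 => by simp [h1] at ih
        positivity
      have h3 : 0 < u n ^ 2 * (u 0 * u (n + 1)) := by
        have := mul_pos ih (h n)
        nlinarith
      exact (pos_iff_pos_of_mul_pos h3).1 h2
  have h1 := h0 N
  have h2 := hu 0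
  rw [zero_add] at h2
  rw [h2] at h1
  nlinarith [mul_self_nonneg (u 0)]

/-- If `a` and `b` have opposite signs, the step from `a` to `b` pays for the step from `a` to `0` and
for the step from `0` to `b`. -/
theorem abs_rpow_add_abs_rpow_le {p a b : ℝ} (hp : 1 ≤ p) (hab : a * b ≤ 0) :
    |a| ^ p + |b| ^ p ≤ |b - a| ^ p := by
  have h1 : |b - a| = |a| + |b| := by
    rcases mul_nonpos_iff.1 hab with ⟨ha, hb⟩ | ⟨ha, hb⟩
    · rw [abs_of_nonneg ha, abs_of_nonpos hb, abs_of_nonpos (by linarith)]; ring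
    · rw [abs_of_nonpos ha, abs_of_nonneg hb, abs_of_nonneg (by linarith)]; ring
  rw [h1]
  have := NNReal.add_rpow_le_rpow_add ⟨|a|, abs_nonneg a⟩ ⟨|b|, abs_nonneg b⟩ hp
  exact_mod_cast this

/-- The discrete Wirtinger inequality for antiperiodic sequences. Between two indices where the sign
changes the sequence is cut and replaced by two sequences of length `m` that start at `0`, one
running forwards and one backwards. -/
theorem sum_rpow_le_of_antiperiodic {p q : ℝ} (hpq : p.HolderConjugate q) {c : ℝ} {Q : ℕ → ℝ}
    {m : ℕ} (hQ : ∀ j, 0 ≤ Q j)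
    (hric : ∀ j < m, c + (p - 1) * Q j ^ q ≤ Q j - Q (j + 1)) {u : ℕ → ℝ}
    (hu : ∀ j, u (j + 2 * m) = -u j) :
    c * ∑ j ∈ Finset.range (2 * m), |u j| ^ p
      ≤ ∑ j ∈ Finset.range (2 * m), |u (j + 1) - u j| ^ p := by
  obtain ⟨k, hk⟩ := exists_mul_succ_nonpos_of_antiperiodic hu
  have hd : ∀ j, |u (j + 2 * m + 1) - u (j + 2 * m)| ^ p = |u (j + 1) - u j| ^ p := fun j => by
    rw [add_right_comm, hu, hu, ← abs_neg]; congr 2; ring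
  rw [← sum_range_add_eq_of_periodic (g := fun j => |u j| ^ p) (fun j => by simp [hu]) (k + 1),
    ← sum_range_add_eq_of_periodic (g := fun j => |u (j + 1) - u j| ^ p) hd k]
  obtain _ | n := m
  · simp
  set w : ℕ → ℝ := fun j => u (k + j) with hw
  have hw0 : w (2 * (n + 1)) = -w 0 := hu k
  have hsign := abs_rpow_add_abs_rpow_le hpq.lt.le hk
  -- the two halves, each of them started from the value `0` at the sign change
  have hl := sum_rpow_le_of_riccati hpq (u := fun j => if j = 0 then 0 else w j) hQ hric (by simp)
  have hr := sum_rpow_le_of_riccati hpq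
    (u := fun j => if j = 0 then 0 else w (2 * (n + 1) + 1 - j)) hQ hric (by simp)
  rw [Finset.sum_range_succ' (fun j => |_ - _| ^ p)] at hl hr
  simp only [Nat.add_eq_zero_iff, one_ne_zero, and_false, if_false, zero_add, if_true, sub_zero,
    Nat.add_sub_cancel, hw0, abs_neg] at hl hr
  have e1 : ∀ j, u (k + 1 + j) = w (j + 1) := fun j => by simp only [hw]; congr 1; ring
  have e2 : ∀ j, u (k + j + 1) = w (j + 1) := fun j => by simp only [hw]; congr 1
  have e3 : u (k + 1) = w 1 := rfl
  have e4 : u k = w 0 := rfl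
  simp only [e1, e2]
  rw [e3, e4] at hsign
  have s1 : ∑ j ∈ Finset.range (2 * (n + 1)), |w (j + 1)| ^ p
      = ∑ j ∈ Finset.range (n + 1), |w (j + 1)| ^ p
        + ∑ j ∈ Finset.range (n + 1), |w (2 * (n + 1) + 1 - (j + 1))| ^ p := by
    rw [two_mul, Finset.sum_range_add,
      ← Finset.sum_range_reflect (fun j => |w (n + 1 + j + 1)| ^ p)]
    congr 1
    refine Finset.sum_congr rfl fun j hj => ?_
    have := Finset.mem_range.1 hj
    congr 3
    omega
  have s2 : ∑ j ∈ Finset.range (2 * (n + 1)), |w (j + 1) - w j| ^ p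
      = ∑ j ∈ Finset.range n, |w (j + 1 + 1) - w (j + 1)| ^ p + |w 1 - w 0| ^ p
        + (∑ j ∈ Finset.range n,
            |w (2 * (n + 1) + 1 - (j + 1 + 1)) - w (2 * (n + 1) + 1 - (j + 1))| ^ p
          + |w (n + 1 + 1) - w (n + 1)| ^ p) := by
    rw [two_mul, Finset.sum_range_add, Finset.sum_range_succ',
      Finset.sum_range_succ' (fun j => |w (n + 1 + j + 1) - w (n + 1 + j)| ^ p),
      ← Finset.sum_range_reflect
        (fun j => |w (n + 1 + (j + 1) + 1) - w (n + 1 + (j + 1))| ^ p)]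
    congr 2
    refine Finset.sum_congr rfl fun j hj => ?_
    have := Finset.mem_range.1 hj
    rw [abs_sub_comm]
    congr 4 <;> omega
  -- the step in the middle, between the ends of the two halves, is not needed
  have hnn : 0 ≤ |w (n + 1 + 1) - w (n + 1)| ^ p := by positivity
  change c * ∑ j ∈ Finset.range (2 * (n + 1)), |w (j + 1)| ^ p
    ≤ ∑ j ∈ Finset.range (2 * (n + 1)), |w (j + 1) - w j| ^ p
  rw [s1, s2, mul_add]
  linarith

/-! ### Implicit Euler steps for `v' = 1 + v ^ q` -/

/-- For times `c` below the time `∫₀^R ds / (1 + s ^ q)` that the solution of `v' = 1 + v ^ q`,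
`v 0 = 0`, needs to reach `R`, and for every fine enough mesh, there are supersolutions of the
implicit Euler scheme on `[0, c]`. They are the values of the solution at slightly longer time
steps, which compensates for evaluating the right-hand side at the end of each step. -/
theorem exists_implicit_euler_steps {q : ℝ} (hq : 0 < q) {c R : ℝ} (hc : 0 < c) (hR : 0 ≤ R)
    (hcR : c < ∫ s in (0 : ℝ)..R, (1 + |s| ^ q)⁻¹) :
    ∀ᶠ m : ℕ in Filter.atTop, ∃ v : ℕ → ℝ, (∀ i, 0 ≤ v i) ∧
      ∀ i < m, c / m * (1 + v (i + 1) ^ q) ≤ v (i + 1) - v i := by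
  set W : ℝ → ℝ := fun s => 1 + |s| ^ q with hW
  have hWc : Continuous W := by
    have := (Real.continuous_rpow_const hq.le).comp continuous_abs
    exact continuous_const.add this
  have hW1 : ∀ s, 1 ≤ W s := fun s => by
    simp only [hW]; linarith [Real.rpow_nonneg (abs_nonneg s) q]
  have hWpos : ∀ s, 0 < W s := fun s => zero_lt_one.trans_le (hW1 s)
  have hWmono : ∀ s t, 0 ≤ s → s ≤ t → W s ≤ W t := fun s t hs hst => by
    simp only [hW, abs_of_nonneg hs, abs_of_nonneg (hs.trans hst)]
    gcongr
  have hGc : Continuous fun s => (W s)⁻¹ := hWc.inv₀ fun s => (hWpos s).ne'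
  have hint : ∀ a b, IntervalIntegrable (fun s => (W s)⁻¹) volume a b :=
    fun a b => hGc.intervalIntegrable a b
  set F : ℝ → ℝ := fun r => ∫ s in (0 : ℝ)..r, (W s)⁻¹ with hF
  set I := F R with hI
  have hcI : c < I := hcR
  have hFc : Continuous F := intervalIntegral.continuous_primitive hint 0
  have hFsub : ∀ a b, F b - F a = ∫ s in a..b, (W s)⁻¹ := fun a b =>
    intervalIntegral.integral_interval_sub_left (hint _ _) (hint _ _)
  have hup : ∀ a b, 0 ≤ a → a ≤ b → F b - F a ≤ (b - a) / W a := fun a b ha hab => by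
    rw [hFsub]
    have := intervalIntegral.integral_mono_on hab (hint a b)
      (intervalIntegrable_const (c := (W a)⁻¹)) fun s hs =>
        inv_anti₀ (hWpos a) (hWmono a s ha hs.1)
    simpa [div_eq_mul_inv] using this
  have hlow : ∀ a b, 0 ≤ a → a ≤ b → b ≤ R → (b - a) / W R ≤ F b - F a := fun a b ha hab hbR => by
    rw [hFsub]
    have := intervalIntegral.integral_mono_on hab
      (intervalIntegrable_const (c := (W R)⁻¹)) (hint a b) fun s hs =>
        inv_anti₀ (hWpos s) (hWmono s R (ha.trans hs.1) (hs.2.trans hbR))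
    simpa [div_eq_mul_inv] using this
  have hIpos : 0 < I := hc.trans hcI
  -- the slack between `c` and `I` absorbs the variation of `W` over one step
  have hε : 0 < I / c - 1 := by
    rw [sub_pos, one_lt_div hc]; exact hcI
  obtain ⟨δ, hδ, hunif⟩ := Metric.uniformContinuousOn_iff.1
    ((isCompact_Icc (a := (0 : ℝ)) (b := R)).uniformContinuousOn_of_continuous hWc.continuousOn)
    (I / c - 1) hε
  have hlim : Filter.Tendsto (fun m : ℕ => I * W R / m) Filter.atTop (nhds 0) :=
    tendsto_const_div_atTop_nhds_zero_nat _
  filter_upwards [hlim.eventually (gt_mem_nhds hδ), Filter.eventually_gt_atTop 0] with m hm hm0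
  have hm0' : (0 : ℝ) < m := by exact_mod_cast hm0
  have hF0 : F 0 = 0 := by simp [hF]
  -- `v i` is the position at time `i * (I / m)`; its value for `i > m` plays no role
  have hex : ∀ i : ℕ, ∃ r ∈ Set.Icc (0 : ℝ) R, i ≤ m → F r = i * (I / m) := by
    intro i
    by_cases hi : i ≤ m
    · have hi' : (i : ℝ) ≤ m := by exact_mod_cast hi
      have hmem : (i : ℝ) * (I / m) ∈ Set.Icc (F 0) (F R) := by
        rw [hF0]
        refine ⟨by positivity, ?_⟩
        calc (i : ℝ) * (I / m) ≤ m * (I / m) := by gcongr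
          _ = I := by field_simp
      obtain ⟨r, hr, hr'⟩ := intermediate_value_Icc hR hFc.continuousOn hmem
      exact ⟨r, hr, fun _ => hr'⟩
    · exact ⟨0, ⟨le_rfl, hR⟩, fun h => absurd h hi⟩
  choose v hv hvF using hex
  refine ⟨v, fun i => (hv i).1, fun i hi => ?_⟩
  have hFi : F (v (i + 1)) - F (v i) = I / m := by
    rw [hvF (i + 1) hi, hvF i hi.le]; push_cast; ring
  have hImpos : 0 < I / m := by positivity
  have hle : v i ≤ v (i + 1) := by
    by_contra! hlt
    have h1 := hlow _ _ (hv (i + 1)).1 hlt.le (hv i).2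
    have h2 : 0 ≤ (v i - v (i + 1)) / W R := div_nonneg (by linarith) (hWpos R).le
    linarith
  have h1 := hlow _ _ (hv i).1 hle (hv (i + 1)).2
  rw [hFi, div_le_iff₀ (hWpos R)] at h1
  have h2 := hup _ _ (hv i).1 hle
  rw [hFi, le_div_iff₀ (hWpos _)] at h2
  have h3 := hunif (v (i + 1)) (hv _) (v i) (hv _) (by
    rw [Real.dist_eq, abs_of_nonneg (by linarith)]
    calc _ ≤ _ := h1
      _ = I * W R / m := by ring
      _ < δ := hm)
  rw [Real.dist_eq] at h3
  have h4 := (le_abs_self _).trans h3.le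
  have h5 : W (v (i + 1)) ≤ I / c * W (v i) := by nlinarith [hW1 (v i)]
  have h6 : W (v (i + 1)) = 1 + v (i + 1) ^ q := by simp only [hW, abs_of_nonneg (hv (i + 1)).1]
  rw [← h6]
  calc c / m * W (v (i + 1)) ≤ c / m * (I / c * W (v i)) := by gcongr
    _ = I / m * W (v i) := by field_simp
    _ ≤ _ := h2

/-! ### The beta integral -/

theorem intervalIntegrable_beta {a b : ℝ} (ha : 0 < a) (hb : 0 < b) :
    IntervalIntegrable (fun t : ℝ => t ^ (a - 1) * (1 - t) ^ (b - 1)) volume 0 1 := by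
  have h := (Complex.betaIntegral_convergent (u := a) (v := b) (by simpa) (by simpa)).norm
  refine h.congr_uIoo ?_
  intro t ht
  rw [Set.uIoo_of_le zero_le_one] at ht
  have h1 : 0 < 1 - t := by linarith [ht.2]
  have e : (1 - (t : ℂ)) = ((1 - t : ℝ) : ℂ) := by push_cast; rfl
  simp only [norm_mul]
  rw [e, Complex.norm_cpow_eq_rpow_re_of_pos ht.1, Complex.norm_cpow_eq_rpow_re_of_pos h1]
  simp

/-- `B(1 - a, a) = π / sin (π a)`, by the reflection formula for the Gamma function. -/
theorem integral_beta_eq_pi_div_sin {a : ℝ} (ha : 0 < a) (ha1 : a < 1) :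
    ∫ t in (0 : ℝ)..1, t ^ (-a) * (1 - t) ^ (a - 1) = Real.pi / Real.sin (Real.pi * a) := by
  rw [← Real.Gamma_mul_Gamma_one_sub]
  have h := ProbabilityTheory.beta_eq_betaIntegralReal (1 - a) a (by linarith) ha
  unfold ProbabilityTheory.beta at h
  rw [sub_add_cancel, Real.Gamma_one, div_one, mul_comm] at h
  rw [h, Complex.betaIntegral, ← Complex.reCLM_apply,
    ← ContinuousLinearMap.intervalIntegral_comp_comm _
      (Complex.betaIntegral_convergent (by simpa using ha1) (by simpa using ha))]
  refine intervalIntegral.integral_congr fun t ht => ?_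
  rw [Set.uIcc_of_le zero_le_one] at ht
  have e : (1 - (t : ℂ)) = ((1 - t : ℝ) : ℂ) := by push_cast; rfl
  have e1 : ((1 - a : ℝ) : ℂ) - 1 = ((-a : ℝ) : ℂ) := by push_cast; ring
  have e2 : (a : ℂ) - 1 = ((a - 1 : ℝ) : ℂ) := by push_cast; ring
  simp only [Complex.reCLM_apply]
  rw [e, e1, e2, ← Complex.ofReal_cpow ht.1, ← Complex.ofReal_cpow (by linarith [ht.2]),
    ← Complex.ofReal_mul, Complex.ofReal_re]

theorem integral_inv_one_add_rpow {p q : ℝ} (hpq : p.HolderConjugate q) {R : ℝ} (hR : 0 ≤ R) :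
    ∫ s in (0 : ℝ)..R, (1 + |s| ^ q)⁻¹
      = q⁻¹ * ∫ t in (0 : ℝ)..(R ^ q / (1 + R ^ q)), t ^ (-(1 / p)) * (1 - t) ^ (1 / p - 1) := by
  have hq := hpq.symm.pos
  have hp := hpq.pos
  have hpos : ∀ s : ℝ, 0 ≤ s → 0 < 1 + s ^ q := fun s hs => by positivity
  have hWc : Continuous fun s : ℝ => s ^ q := Real.continuous_rpow_const hq.le
  have hτc : ContinuousOn (fun s : ℝ => s ^ q / (1 + s ^ q)) (Set.Icc 0 R) :=
    hWc.continuousOn.div (continuous_const.add hWc).continuousOn fun s hs => (hpos s hs.1).ne'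
  have hGint : IntervalIntegrable (fun s : ℝ => (1 + |s| ^ q)⁻¹) volume 0 R := by
    refine Continuous.intervalIntegrable ?_ _ _
    refine Continuous.inv₀ (continuous_const.add
      ((Real.continuous_rpow_const hq.le).comp continuous_abs)) fun s => ?_
    have : 0 ≤ |s| ^ q := by positivity
    positivity
  -- the substitution `t = s ^ q / (1 + s ^ q)` turns one integrand into the other
  have hsub : ∀ s : ℝ, 0 < s →
      (s ^ q / (1 + s ^ q)) ^ (-(1 / p)) * (1 - s ^ q / (1 + s ^ q)) ^ (1 / p - 1)
        * (q * s ^ (q - 1) / (1 + s ^ q) ^ 2) = q * (1 + |s| ^ q)⁻¹ := by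
    intro s hs
    have hD := hpos s hs.le
    set D := 1 + s ^ q with hDdef
    have e1 : 1 - s ^ q / D = D⁻¹ := by
      field_simp
      rw [hDdef]; ring
    have e2 : (s ^ q) ^ (-(1 / p)) * s ^ (q - 1) = 1 := by
      rw [← Real.rpow_mul hs.le, ← Real.rpow_add hs]
      have : q * -(1 / p) + (q - 1) = 0 := by
        rw [hpq.conjugate_eq]
        have := hpq.sub_one_ne_zero
        field_simp
        ring
      rw [this, Real.rpow_zero]
    have e3 : (D⁻¹) ^ (-(1 / p)) * (D⁻¹) ^ (1 / p - 1) = D := by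
      rw [← Real.rpow_add (by positivity)]
      have : -(1 / p) + (1 / p - 1) = -1 := by ring
      rw [this, Real.rpow_neg_one, inv_inv]
    rw [abs_of_pos hs, ← hDdef, e1, div_eq_mul_inv (s ^ q),
      Real.mul_rpow (by positivity) (by positivity)]
    calc (s ^ q) ^ (-(1 / p)) * D⁻¹ ^ (-(1 / p)) * D⁻¹ ^ (1 / p - 1) * (q * s ^ (q - 1) / D ^ 2)
        = ((s ^ q) ^ (-(1 / p)) * s ^ (q - 1)) * (D⁻¹ ^ (-(1 / p)) * D⁻¹ ^ (1 / p - 1))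
            * (q / D ^ 2) := by ring
      _ = q * D⁻¹ := by rw [e2, e3]; field_simp
  have hmem : ∀ s ∈ Set.Icc (0 : ℝ) R, s ^ q / (1 + s ^ q) ∈ Set.Icc (0 : ℝ) 1 := fun s hs => by
    have := hpos s hs.1
    have h0 : 0 ≤ s ^ q := Real.rpow_nonneg hs.1 _
    refine ⟨by positivity, ?_⟩
    rw [div_le_one this]; linarith
  have hbint := intervalIntegrable_beta (a := 1 - 1 / p) (b := 1 / p)
    (by rw [one_div]; linarith [inv_lt_one_of_one_lt₀ hpq.lt]) (by positivity)
  rw [intervalIntegrable_iff_integrableOn_Icc_of_le zero_le_one] at hbint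
  have hbint' :
      IntegrableOn (fun t : ℝ => t ^ (-(1 / p)) * (1 - t) ^ (1 / p - 1)) (Set.Icc 0 1) := by
    have : 1 - 1 / p - 1 = -(1 / p) := by ring
    rwa [this] at hbint
  have key := intervalIntegral.integral_comp_mul_deriv''' (a := 0) (b := R)
    (f := fun s : ℝ => s ^ q / (1 + s ^ q)) (f' := fun s => q * s ^ (q - 1) / (1 + s ^ q) ^ 2)
    (g := fun t : ℝ => t ^ (-(1 / p)) * (1 - t) ^ (1 / p - 1))
    (by rwa [Set.uIcc_of_le hR])
    (fun s hs => by
      rw [min_eq_left hR] at hs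
      have h1 := Real.hasDerivAt_rpow_const (x := s) (p := q) (Or.inl hs.1.ne')
      have h2 := (h1.div (h1.const_add 1) (hpos s hs.1.le).ne').hasDerivWithinAt (s := Set.Ioi s)
      refine h2.congr_deriv ?_
      congr 1
      ring)
    (by
      rintro t ⟨s, hs, rfl⟩
      rw [min_eq_left hR] at hs
      have h0 : 0 < s ^ q := Real.rpow_pos_of_pos hs.1 _
      have h1 : 0 < s ^ q / (1 + s ^ q) := by positivity
      have h2 : 0 < 1 - s ^ q / (1 + s ^ q) := by
        rw [sub_pos, div_lt_one (by positivity)]; linarith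
      refine ContinuousAt.continuousWithinAt ?_
      exact (Real.continuousAt_rpow_const _ _ (Or.inl h1.ne')).mul
        ((continuousAt_const.sub continuousAt_id).rpow_const (Or.inl h2.ne')))
    (hbint'.mono_set (by
      rw [Set.uIcc_of_le hR]
      rintro t ⟨s, hs, rfl⟩
      exact hmem s hs))
    (by
      rw [Set.uIcc_of_le hR, ← intervalIntegrable_iff_integrableOn_Icc_of_le hR]
      refine (hGint.const_mul q).congr_uIoo fun s hs => ?_
      rw [Set.uIoo_of_le hR] at hs
      exact (hsub s hs.1).symm)
  simp only [Function.comp_def] at key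
  rw [Real.zero_rpow hq.ne', zero_div] at key
  rw [← key, ← intervalIntegral.integral_const_mul]
  refine intervalIntegral.integral_congr_ae ?_
  refine Filter.Eventually.of_forall fun s hs => ?_
  rw [Set.uIoc_of_le hR] at hs
  rw [hsub s hs.1]
  field_simp

theorem exists_lt_integral_inv_one_add_rpow {p q : ℝ} (hpq : p.HolderConjugate q) {c : ℝ}
    (hc : c < q⁻¹ * ∫ t in (0 : ℝ)..1, t ^ (-(1 / p)) * (1 - t) ^ (1 / p - 1)) :
    ∃ R, 0 ≤ R ∧ c < ∫ s in (0 : ℝ)..R, (1 + |s| ^ q)⁻¹ := by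
  have hq := hpq.symm.pos
  have hp := hpq.pos
  have hbint := intervalIntegrable_beta (a := 1 - 1 / p) (b := 1 / p)
    (by rw [one_div]; linarith [inv_lt_one_of_one_lt₀ hpq.lt]) (by positivity)
  rw [show 1 - 1 / p - 1 = -(1 / p) by ring] at hbint
  have hcont := intervalIntegral.continuousOn_primitive_interval (a := (0 : ℝ)) (b := 1)
    (μ := volume) (f := fun t : ℝ => t ^ (-(1 / p)) * (1 - t) ^ (1 / p - 1))
    (by
      rwa [Set.uIcc_of_le zero_le_one,
        ← intervalIntegrable_iff_integrableOn_Icc_of_le zero_le_one])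
  rw [Set.uIcc_of_le zero_le_one] at hcont
  have hlim : Filter.Tendsto (fun s : ℝ => s / (1 + s)) Filter.atTop (nhds 1) := by
    have h1 : Filter.Tendsto (fun s : ℝ => 1 - (1 + s)⁻¹) Filter.atTop (nhds (1 - 0)) :=
      tendsto_const_nhds.sub
        (tendsto_inv_atTop_zero.comp (Filter.tendsto_atTop_add_const_left _ 1 Filter.tendsto_id))
    rw [sub_zero] at h1
    refine h1.congr' ?_
    filter_upwards [Filter.eventually_gt_atTop 0] with s hs
    field_simp
    ring
  have hlim' : Filter.Tendsto (fun R : ℝ => R ^ q / (1 + R ^ q)) Filter.atTop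
      (nhdsWithin 1 (Set.Icc 0 1)) := by
    refine tendsto_nhdsWithin_iff.2 ⟨hlim.comp (tendsto_rpow_atTop hq), ?_⟩
    filter_upwards [Filter.eventually_gt_atTop 0] with R hR
    have : 0 < R ^ q := Real.rpow_pos_of_pos hR _
    refine ⟨by positivity, ?_⟩
    rw [div_le_one (by positivity)]; linarith
  have h := ((hcont 1 (Set.right_mem_Icc.2 zero_le_one)).tendsto.comp hlim').const_mul q⁻¹
  obtain ⟨R, hR, hR0⟩ := ((h.eventually (lt_mem_nhds hc)).and (Filter.eventually_ge_atTop 0)).exists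
  refine ⟨R, hR0, ?_⟩
  rwa [integral_inv_one_add_rpow hpq hR0]

/-! ### The lower bound for the reciprocal of the constant -/

/-- This says that `a ↦ log (a ^ (1 - a) * (1 - a) ^ a / sin (π a))` has a nonnegative derivative. At
`a = 20/67` the elementary bounds used for `sin`, `cos` and `log` leave little room. -/
theorem pi_mul_cot_le {a : ℝ} (ha : 20 / 67 ≤ a) (ha2 : a ≤ 1 / 2) :
    Real.pi * (Real.cos (Real.pi * a) / Real.sin (Real.pi * a))
      ≤ (1 - a) / a - a / (1 - a) + (Real.log (1 - a) - Real.log a) := by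
  have ha0 : 0 < a := by linarith
  have h1a : 0 < 1 - a := by linarith
  have hπ := Real.pi_pos
  have hlog : 1 - a / (1 - a) ≤ Real.log (1 - a) - Real.log a := by
    rw [← Real.log_div h1a.ne' ha0.ne']
    simpa using Real.one_sub_inv_le_log_of_pos (div_pos h1a ha0)
  -- in terms of `w = 1 - 2 a`, the cotangent is the tangent of `π w / 2`
  obtain ⟨w, rfl⟩ : ∃ w, a = (1 - w) / 2 := ⟨1 - 2 * a, by ring⟩
  have hw0 : 0 ≤ w := by linarith
  have hw1 : w ≤ 27 / 67 := by linarith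
  have e : Real.pi * ((1 - w) / 2) = Real.pi / 2 - Real.pi * w / 2 := by ring
  rw [e, Real.cos_pi_div_two_sub, Real.sin_pi_div_two_sub]
  set y := Real.pi * w / 2 with hy
  have hy0 : 0 ≤ y := by positivity
  have hsin : Real.sin y ≤ y := Real.sin_le hy0
  have hcos : 1 - y ^ 2 / 2 ≤ Real.cos y := Real.one_sub_sq_div_two_le_cos
  have hπ2 : Real.pi ^ 2 ≤ 9.87 := by nlinarith [Real.pi_lt_d4]
  have hy2 : y ^ 2 / 2 ≤ 1.23375 * w ^ 2 := by
    have : y ^ 2 / 2 = Real.pi ^ 2 * w ^ 2 / 8 := by rw [hy]; ring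
    rw [this]
    nlinarith [sq_nonneg w]
  have hw2 : w ^ 2 ≤ 0.1625 := by nlinarith
  have hden : 0 < 1 - 1.23375 * w ^ 2 := by linarith
  have hdenw : 0 < 1 - w ^ 2 := by linarith
  have hcos' : 1 - 1.23375 * w ^ 2 ≤ Real.cos y := by linarith
  have h1 : Real.pi * (Real.sin y / Real.cos y) ≤ 4.935 * w / (1 - 1.23375 * w ^ 2) := by
    calc Real.pi * (Real.sin y / Real.cos y) ≤ Real.pi * (y / (1 - 1.23375 * w ^ 2)) := by
          gcongr
      _ = Real.pi ^ 2 * w / 2 / (1 - 1.23375 * w ^ 2) := by rw [hy]; ring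
      _ ≤ _ := by
        gcongr
        nlinarith
  have h2 : 4.935 * w / (1 - 1.23375 * w ^ 2) ≤ (6 - 2 * w) * w / (1 - w ^ 2) := by
    rw [div_le_div_iff₀ hden hdenw]
    have hcub : 0 ≤ 2.13 - 4 * w - 4.935 * w ^ 2 + 4.935 * w ^ 3 := by
      nlinarith [mul_nonneg hw0 (sub_nonneg.2 hw1), mul_nonneg (sq_nonneg w) (sub_nonneg.2 hw1),
        mul_nonneg hw0 (mul_self_nonneg (27 / 67 - w)),
        mul_nonneg (sub_nonneg.2 hw1) (mul_self_nonneg (27 / 67 - w))]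
    nlinarith [mul_nonneg hw0 hcub]
  have h3 : (6 - 2 * w) * w / (1 - w ^ 2) = (1 - (1 - w) / 2) / ((1 - w) / 2)
      - (1 - w) / 2 / (1 - (1 - w) / 2) + (1 - (1 - w) / 2 / (1 - (1 - w) / 2)) := by
    have e1 : 1 - (1 - w) / 2 = (1 + w) / 2 := by ring
    have e2 : 1 - w ≠ 0 := by linarith
    have e3 : 1 + w ≠ 0 := by linarith
    rw [e1, show 1 - w ^ 2 = (1 - w) * (1 + w) by ring]
    field_simp
    ring
  linarith

/-- The angle is close to `3 π / 10`, the complement of `π / 5`, whose cosine is known exactly. -/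
theorem sin_pi_mul_lt : Real.sin (Real.pi * (20 / 67)) < 0.8065 := by
  have hπ := Real.pi_gt_d4
  have hπ' := Real.pi_lt_d4
  have e : Real.pi * (20 / 67) = Real.pi / 2 - (Real.pi / 5 + Real.pi / 670) := by ring
  rw [e, Real.sin_pi_div_two_sub, Real.cos_add]
  have hδ : 0.00468 ≤ Real.pi / 670 := by linarith
  have hδ' : Real.pi / 670 ≤ 0.0047 := by linarith
  have h5 : √5 < 2.2361 := by
    rw [Real.sqrt_lt' (by norm_num)]; norm_num
  have hc : Real.cos (Real.pi / 5) < 0.809025 := by rw [Real.cos_pi_div_five]; linarith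
  have hc0 : 0 ≤ Real.cos (Real.pi / 5) := by rw [Real.cos_pi_div_five]; positivity
  have hs : 0.58 < Real.sin (Real.pi / 5) := by
    have h0 : 0 ≤ Real.sin (Real.pi / 5) :=
      Real.sin_nonneg_of_nonneg_of_le_pi (by positivity) (by linarith)
    nlinarith [Real.sin_sq_add_cos_sq (Real.pi / 5)]
  have hs' : 0.0046 < Real.sin (Real.pi / 670) := by
    have := Real.sin_gt_sub_cube (x := Real.pi / 670) (by positivity)
    have : (Real.pi / 670) ^ 3 ≤ 0.0047 ^ 3 := by gcongr
    norm_num at this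
    linarith
  have h1 := mul_le_mul_of_nonneg_left (Real.cos_le_one (Real.pi / 670)) hc0
  nlinarith

theorem six_mul_sin_lt {a : ℝ} (ha : 20 / 67 ≤ a) (ha2 : a ≤ 1 / 2) :
    6 * Real.sin (Real.pi * a) < 4 * Real.pi * (a ^ (1 - a) * (1 - a) ^ a) := by
  have hsinpos : ∀ x, 20 / 67 ≤ x → x ≤ 1 / 2 → 0 < Real.sin (Real.pi * x) := fun x hx hx2 =>
    Real.sin_pos_of_pos_of_lt_pi (by have := Real.pi_pos; positivity) (by nlinarith [Real.pi_pos])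
  set h : ℝ → ℝ := fun x => (1 - x) * Real.log x + x * Real.log (1 - x)
    - Real.log (Real.sin (Real.pi * x)) with hh
  have hderiv : ∀ x ∈ Set.Icc (20 / 67 : ℝ) (1 / 2), HasDerivAt h
      ((1 - x) / x - x / (1 - x) + (Real.log (1 - x) - Real.log x)
        - Real.pi * (Real.cos (Real.pi * x) / Real.sin (Real.pi * x))) x := by
    intro x hx
    have hx0 : x ≠ 0 := by linarith [hx.1]
    have hx1 : 1 - x ≠ 0 := by linarith [hx.2]
    have d1 : HasDerivAt (fun x : ℝ => 1 - x) (-1) x := (hasDerivAt_id x).const_sub 1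
    have d2 : HasDerivAt (fun x : ℝ => Real.sin (Real.pi * x))
        (Real.cos (Real.pi * x) * Real.pi) x := by
      simpa using ((hasDerivAt_id x).const_mul Real.pi).sin
    have := ((d1.mul (Real.hasDerivAt_log hx0)).add ((hasDerivAt_id x).mul (d1.log hx1))).sub
      (d2.log (hsinpos x hx.1 hx.2).ne')
    refine this.congr_deriv ?_
    simp only [id]
    ring
  have hmono : MonotoneOn h (Set.Icc (20 / 67 : ℝ) (1 / 2)) := by
    refine monotoneOn_of_deriv_nonneg (convex_Icc _ _)
      (fun x hx => (hderiv x hx).continuousAt.continuousWithinAt)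
      (fun x hx => (hderiv x (interior_subset hx)).differentiableAt.differentiableWithinAt)
      fun x hx => ?_
    have hx' := interior_subset hx
    rw [(hderiv x hx').deriv]
    linarith [pi_mul_cot_le hx'.1 hx'.2]
  have hexp : ∀ x, 20 / 67 ≤ x → x ≤ 1 / 2 →
      Real.exp (h x) * Real.sin (Real.pi * x) = x ^ (1 - x) * (1 - x) ^ x := by
    intro x hx hx2
    have hx0 : 0 < x := by linarith
    have hx1 : 0 < 1 - x := by linarith
    simp only [hh]
    rw [Real.exp_sub, Real.exp_log (hsinpos x hx hx2), div_mul_cancel₀ _ (hsinpos x hx hx2).ne',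
      Real.exp_add, Real.rpow_def_of_pos hx0, Real.rpow_def_of_pos hx1, mul_comm (1 - x), mul_comm x]
  -- `25.81 ^ 67 ≤ 20 ^ 47 * 47 ^ 20`
  have hend : 25.81 / 67 ≤ (20 / 67 : ℝ) ^ (1 - 20 / 67 : ℝ) * (1 - 20 / 67) ^ (20 / 67 : ℝ) := by
    have e : (20 / 67 : ℝ) ^ (1 - 20 / 67 : ℝ) * (1 - 20 / 67) ^ (20 / 67 : ℝ)
        = ((20 / 67 : ℝ) ^ 47 * (47 / 67) ^ 20) ^ (67 : ℝ)⁻¹ := by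
      rw [Real.mul_rpow (by positivity) (by positivity), ← Real.rpow_natCast, ← Real.rpow_natCast,
        ← Real.rpow_mul (by norm_num), ← Real.rpow_mul (by norm_num)]
      norm_num
    rw [e, Real.le_rpow_inv_iff_of_pos (by norm_num) (by positivity) (by norm_num)]
    have : (25.81 / 67 : ℝ) ^ (67 : ℝ) = (25.81 / 67 : ℝ) ^ (67 : ℕ) := by
      exact_mod_cast Real.rpow_natCast (25.81 / 67 : ℝ) 67
    rw [this]
    norm_num
  have h0 := hexp (20 / 67) le_rfl (by norm_num)
  have hs0 := hsinpos (20 / 67) le_rfl (by norm_num)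
  have hend' : 6 < 4 * Real.pi * Real.exp (h (20 / 67)) := by
    have h1 : 25.81 / 67 ≤ Real.exp (h (20 / 67)) * 0.8065 := by
      rw [← h0] at hend
      exact hend.trans (mul_le_mul_of_nonneg_left sin_pi_mul_lt.le (Real.exp_pos _).le)
    nlinarith [Real.pi_gt_d4, Real.exp_pos (h (20 / 67))]
  have hle : Real.exp (h (20 / 67)) ≤ Real.exp (h a) :=
    Real.exp_le_exp.2 (hmono (Set.left_mem_Icc.2 (by norm_num)) ⟨ha, ha2⟩ ha)
  rw [← hexp a ha ha2, ← mul_assoc]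
  refine mul_lt_mul_of_pos_right ?_ (hsinpos a ha ha2)
  exact hend'.trans_le (mul_le_mul_of_nonneg_left hle (by have := Real.pi_pos; positivity))

theorem inv_wirtingerConst (p : ℝ) :
    (wirtingerConst p)⁻¹ = 4 * (p - 1) ^ (1 / p) *
      (∫ t in (0 : ℝ)..1, t ^ (-(1 / p)) * (1 - t) ^ (1 / p - 1)) / p := by
  rw [wirtingerConst, inv_div]

/-- With `a = 1 / p` the right-hand side is symmetric under `a ↦ 1 - a`. -/
theorem inv_wirtingerConst_eq_pi {p : ℝ} (hp : 1 < p) :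
    (wirtingerConst p)⁻¹ = 4 * Real.pi * ((1 / p) ^ (1 - 1 / p) * (1 - 1 / p) ^ (1 / p))
      / Real.sin (Real.pi * (1 / p)) := by
  have hp0 : 0 < p := by linarith
  have ha : 0 < 1 / p := by positivity
  have ha1 : 1 / p < 1 := by rw [div_lt_one hp0]; exact hp
  rw [inv_wirtingerConst, integral_beta_eq_pi_div_sin ha ha1]
  have e : (p - 1) ^ (1 / p) / p = (1 / p) ^ (1 - 1 / p) * (1 - 1 / p) ^ (1 / p) := by
    have e1 : p - 1 = (1 - 1 / p) / (1 / p) := by field_simp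
    rw [e1, Real.div_rpow (by linarith) ha.le, Real.rpow_sub ha, Real.rpow_one]
    field_simp
  rw [← e]
  ring

theorem six_lt_inv_wirtingerConst {p : ℝ} (h1 : 1.43 ≤ p) (h2 : p ≤ 3.35) :
    6 < (wirtingerConst p)⁻¹ := by
  have hp0 : 0 < p := by linarith
  have hp1 : 1 < p := by linarith
  rw [inv_wirtingerConst_eq_pi hp1]
  have ha : 20 / 67 ≤ 1 / p := by
    rw [div_le_div_iff₀ (by norm_num) hp0]; linarith
  have ha' : 1 / p ≤ 47 / 67 := by
    rw [div_le_div_iff₀ hp0 (by norm_num)]; linarith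
  set a := 1 / p
  have hs : 0 < Real.sin (Real.pi * a) :=
    Real.sin_pos_of_pos_of_lt_pi (by have := Real.pi_pos; positivity) (by nlinarith [Real.pi_pos])
  rw [lt_div_iff₀ hs]
  rcases le_total a (1 / 2) with h | h
  · exact six_mul_sin_lt ha h
  · have := six_mul_sin_lt (a := 1 - a) (by linarith) (by linarith)
    rwa [mul_sub, mul_one, Real.sin_pi_sub, sub_sub_cancel, mul_comm ((1 - a) ^ a)] at this

/-! ### Transfer to `ℓ^p` and `L^p` -/

/-- Every discrete Wirtinger inequality with exponent `p` that holds for real antiperiodic sequences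
of half-period `N` holds, with the same constant `c`, for antiperiodic sequences in `X`. Spaces whose
norm is an `ℓ^p` or `L^p` norm have this property, by summation or integration over the points.
Only the values on one half-period enter the sums. -/
def InheritsDiscreteWirtinger (X : Type*) [NormedAddCommGroup X] (p : ℝ) : Prop :=
  ∀ (N : ℕ) (c : ℝ),
    (∀ u : ℕ → ℝ, (∀ j, u (j + N) = -u j) →
      c * ∑ j ∈ Finset.range N, |u j| ^ p ≤ ∑ j ∈ Finset.range N, |u (j + 1) - u j| ^ p) →
    ∀ z : ℕ → X, (∀ j, z (j + N) = -z j) →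
      c * ∑ j ∈ Finset.range N, ‖z j‖ ^ p ≤ ∑ j ∈ Finset.range N, ‖z (j + 1) - z j‖ ^ p

theorem inheritsDiscreteWirtinger_piLp {ι : Type*} [Fintype ι] {p : ℝ≥0∞} [Fact (1 ≤ p)]
    (hp : 0 < p.toReal) : InheritsDiscreteWirtinger (PiLp p fun _ : ι => ℝ) p.toReal := by
  intro N c h z hz
  have hn : ∀ w : PiLp p fun _ : ι => ℝ, ‖w‖ ^ p.toReal = ∑ i, |w i| ^ p.toReal := fun w => by
    rw [PiLp.norm_eq_sum hp, ← Real.rpow_mul (Finset.sum_nonneg fun i _ => by positivity),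
      one_div_mul_cancel hp.ne', Real.rpow_one]
    rfl
  simp only [hn]
  rw [Finset.sum_comm, Finset.sum_comm (s := Finset.range N), Finset.mul_sum]
  refine Finset.sum_le_sum fun i _ => ?_
  exact h (fun j => z j i) fun j => by rw [hz]; rfl

theorem inheritsDiscreteWirtinger_lp {M : Type*} [MeasurableSpace M] {μ : Measure M} {p : ℝ≥0∞}
    [Fact (1 ≤ p)] (hp_top : p ≠ ∞) : InheritsDiscreteWirtinger (Lp ℝ p μ) p.toReal := by
  intro N c h z hz
  have hp0 : p ≠ 0 := (zero_lt_one.trans_le Fact.out).ne'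
  have hp : 0 < p.toReal := ENNReal.toReal_pos hp0 hp_top
  have hint : ∀ w : Lp ℝ p μ, Integrable (fun x => |w x| ^ p.toReal) μ := fun w => by
    simpa using (Lp.memLp w).integrable_norm_rpow hp0 hp_top
  have hn : ∀ w : Lp ℝ p μ, ‖w‖ ^ p.toReal = ∫ x, |w x| ^ p.toReal ∂μ := fun w => by
    rw [Lp.norm_def, (Lp.memLp w).eLpNorm_eq_integral_rpow_norm hp0 hp_top,
      ENNReal.toReal_ofReal (by positivity), ← Real.rpow_mul (by positivity),
      inv_mul_cancel₀ hp.ne', Real.rpow_one]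
    rfl
  simp only [hn]
  rw [← integral_finsetSum _ fun j _ => hint _, ← integral_finsetSum _ fun j _ => hint _,
    ← integral_const_mul]
  refine integral_mono_ae ((integrable_finsetSum _ fun j _ => hint _).const_mul c)
    (integrable_finsetSum _ fun j _ => hint _) ?_
  have h1 : ∀ᵐ x ∂μ, ∀ j, z (j + N) x = -z j x := ae_all_iff.2 fun j => by
    rw [hz]; exact Lp.coeFn_neg _
  have h2 : ∀ᵐ x ∂μ, ∀ j, (z (j + 1) - z j : Lp ℝ p μ) x = z (j + 1) x - z j x :=
    ae_all_iff.2 fun j => Lp.coeFn_sub _ _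
  filter_upwards [h1, h2] with x hx1 hx2
  simp only [hx2]
  exact h (fun j => z j x) hx1

/-! ### The asymptotically sharp constant -/

/-- The discrete Wirtinger inequality, with a constant that is asymptotically sharp: any `c < C_p⁻¹`
is admissible for fine enough meshes. -/
theorem eventually_wirtinger_of_antiperiodic {p : ℝ} (hp : 1 < p) {c : ℝ} (hc : 0 < c)
    (hcp : c < (wirtingerConst p)⁻¹) :
    ∀ᶠ m : ℕ in Filter.atTop, ∀ u : ℕ → ℝ, (∀ j, u (j + 2 * m) = -u j) →
      (c / (4 * m)) ^ p * ∑ j ∈ Finset.range (2 * m), |u j| ^ p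
        ≤ ∑ j ∈ Finset.range (2 * m), |u (j + 1) - u j| ^ p := by
  have hp0 : 0 < p := by linarith
  have hp1 : 0 < p - 1 := by linarith
  set q := p.conjExponent with hq
  have hpq : p.HolderConjugate q := Real.HolderConjugate.conjExponent hp
  have hq0 := hpq.symm.pos
  -- The Riccati equation `-Q' = λ + (p - 1) Q ^ q` becomes `v' = 1 + v ^ q` on scaling `Q` by `κ` and
  -- reversing time; `d` is the time that `v` has to live.
  set d := c / 4 * (p - 1) ^ (1 - 1 / p) with hd
  have hd0 : 0 < d := by positivity
  have hdB : d < q⁻¹ * ∫ t in (0 : ℝ)..1, t ^ (-(1 / p)) * (1 - t) ^ (1 / p - 1) := by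
    rw [inv_wirtingerConst] at hcp
    set B := ∫ t in (0 : ℝ)..1, t ^ (-(1 / p)) * (1 - t) ^ (1 / p - 1)
    have e : (p - 1) ^ (1 / p) * (p - 1) ^ (1 - 1 / p) = p - 1 := by
      rw [← Real.rpow_add hp1, add_sub_cancel, Real.rpow_one]
    have hqe : q⁻¹ = (p - 1) / p := by rw [hq, Real.conjExponent, inv_div]
    calc d < 4 * (p - 1) ^ (1 / p) * B / p / 4 * (p - 1) ^ (1 - 1 / p) := by
          rw [hd]; gcongr
      _ = ((p - 1) ^ (1 / p) * (p - 1) ^ (1 - 1 / p)) / p * B := by ring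
      _ = q⁻¹ * B := by rw [e, hqe]
  obtain ⟨R, hR, hdR⟩ := exists_lt_integral_inv_one_add_rpow hpq hdB
  filter_upwards [exists_implicit_euler_steps hq0 hd0 hR hdR, Filter.eventually_gt_atTop 0]
    with m ⟨v, hv0, hv⟩ hm u hu
  have hm' : (0 : ℝ) < m := by exact_mod_cast hm
  set κ := (d / m / (p - 1)) ^ (p - 1) with hκ
  have hk : 0 < d / m / (p - 1) := by positivity
  have hκ0 : 0 < κ := by positivity
  have hκq : (p - 1) * κ ^ q = κ * (d / m) := by
    have e1 : κ ^ q = κ * (d / m / (p - 1)) := by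
      rw [hκ, ← Real.rpow_mul hk.le, hpq.sub_one_mul_conj, ← Real.rpow_add_one hk.ne',
        sub_add_cancel]
    rw [e1]; field_simp
  have hconst : κ * (d / m) = (c / (4 * m)) ^ p := by
    have e1 : d / m = c / (4 * m) * (p - 1) ^ (1 - 1 / p) := by rw [hd]; ring
    have e2 : d / m / (p - 1) = c / (4 * m) * (p - 1) ^ (-(1 / p)) := by
      rw [e1, show 1 - 1 / p = -(1 / p) + 1 by ring, Real.rpow_add_one hp1.ne']
      field_simp
    have hx : 0 < c / (4 * m) := by positivity
    rw [hκ, e2, e1, Real.mul_rpow hx.le (by positivity), ← Real.rpow_mul hp1.le]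
    calc _ = ((c / (4 * m)) ^ (p - 1) * (c / (4 * m)))
          * ((p - 1) ^ (-(1 / p) * (p - 1)) * (p - 1) ^ (1 - 1 / p)) := by ring
      _ = _ := by
        rw [← Real.rpow_add_one hx.ne', ← Real.rpow_add hp1, sub_add_cancel,
          show -(1 / p) * (p - 1) + (1 - 1 / p) = 0 by field_simp; ring, Real.rpow_zero, mul_one]
  rw [← hconst]
  refine sum_rpow_le_of_antiperiodic hpq (Q := fun j => κ * v (m - j))
    (fun j => mul_nonneg hκ0.le (hv0 _)) (fun j hj => ?_) hu
  have h1 := hv (m - (j + 1)) (by omega)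
  rw [show m - (j + 1) + 1 = m - j by omega] at h1
  have h2 := mul_le_mul_of_nonneg_left h1 hκ0.le
  rw [Real.mul_rpow hκ0.le (hv0 _), ← mul_assoc, hκq]
  linarith

/-! ### Periodic solutions -/

/-- The growth over time `h` of the difference of two solutions, by Grönwall and the mean value
inequality. -/
theorem norm_sub_le_of_ode {X : Type*} [NormedAddCommGroup X] [NormedSpace ℝ X] {f : X → X}
    {L : ℝ≥0} (hf : LipschitzWith L f) {x y : ℝ → X} (hx : ∀ t, HasDerivAt x (f (x t)) t)
    (hy : ∀ t, HasDerivAt y (f (y t)) t) (t : ℝ) {h : ℝ} (hh : 0 ≤ h) :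
    ‖(x (t + h) - y (t + h)) - (x t - y t)‖
      ≤ L * h * Real.exp (L * h) * ‖x t - y t‖ := by
  have hgron := dist_le_of_trajectories_ODE (v := fun _ => f) (K := L) (f := x) (g := y) (a := t)
    (b := t + h) (fun _ => hf)
    (fun s _ => (hx s).continuousAt.continuousWithinAt) (fun s _ => (hx s).hasDerivWithinAt)
    (fun s _ => (hy s).continuousAt.continuousWithinAt) (fun s _ => (hy s).hasDerivWithinAt) le_rfl
  have hbound : ∀ s ∈ Set.Ico t (t + h), ‖f (x s) - f (y s)‖
      ≤ L * (dist (x t) (y t) * Real.exp (L * h)) := fun s hs => by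
    rw [← dist_eq_norm]
    refine (hf.dist_le_mul _ _).trans ?_
    gcongr
    refine (hgron s ⟨hs.1, hs.2.le⟩).trans ?_
    gcongr
    linarith [hs.2]
  have := norm_image_sub_le_of_norm_deriv_le_segment' (f := fun s => x s - y s)
    (fun s _ => ((hx s).sub (hy s)).hasDerivWithinAt) hbound (t + h) ⟨by linarith, le_rfl⟩
  refine this.trans_eq ?_
  rw [dist_eq_norm]
  ring

/-- Otherwise the antiperiodic sequence `z` of the values of `x (t + T / 2) - x t` on a fine mesh,
started where this difference is nonzero, violates the discrete Wirtinger inequality. -/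
theorem periodic_half_of_mul_lt {X : Type*} [NormedAddCommGroup X] [NormedSpace ℝ X] {p : ℝ}
    (hp : 1 < p) (hX : InheritsDiscreteWirtinger X p) {f : X → X} {x : ℝ → X} {T : ℝ} {L : ℝ≥0}
    (hf : LipschitzWith L f) (hx : ∀ t, HasDerivAt x (f (x t)) t) (hT : 0 < T)
    (hper : Function.Periodic x T) (hlt : T * L < (wirtingerConst p)⁻¹) :
    Function.Periodic x (T / 2) := by
  have hp0 : 0 < p := by linarith
  intro t₀
  by_contra hne
  obtain ⟨c, hc1, hc2⟩ := exists_between hlt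
  have hc0 : 0 < c := lt_of_le_of_lt (by positivity) hc1
  have hlim : Filter.Tendsto (fun m : ℕ => T * L * Real.exp (L * T / 4 / m)) Filter.atTop
      (nhds (T * L)) := by
    have h1 := (tendsto_const_div_atTop_nhds_zero_nat (L * T / 4)).rexp.const_mul (T * L)
    simpa using h1
  obtain ⟨m, ⟨hW, hm⟩, hm0⟩ := (((eventually_wirtinger_of_antiperiodic hp hc0 hc2).and
    (hlim.eventually (gt_mem_nhds hc1))).and (Filter.eventually_gt_atTop 0)).exists
  have hm' : (0 : ℝ) < m := by exact_mod_cast hm0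
  set h := T / (4 * m) with hh
  have hh0 : 0 < h := by positivity
  set z : ℕ → X := fun j => x (t₀ + j * h + T / 2) - x (t₀ + j * h) with hz
  have hanti : ∀ j, z (j + 2 * m) = -z j := fun j => by
    have e : t₀ + ((j + 2 * m : ℕ) : ℝ) * h = t₀ + j * h + T / 2 := by
      rw [hh]; push_cast; field_simp; ring
    simp only [hz]
    rw [e, add_assoc _ (T / 2), add_halves, hper, neg_sub]
  have hineq := hX (2 * m) ((c / (4 * m)) ^ p) hW z hanti
  have hshift : ∀ t, HasDerivAt (fun s => x (s + T / 2)) (f (x (t + T / 2))) t := fun t =>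
    (hx (t + T / 2)).comp_add_const t (T / 2)
  have hstep : ∀ j, ‖z (j + 1) - z j‖ ^ p
      ≤ (L * h * Real.exp (L * h)) ^ p * ‖z j‖ ^ p := fun j => by
    have := norm_sub_le_of_ode hf hshift hx (t₀ + j * h) hh0.le
    rw [← Real.mul_rpow (by positivity) (by positivity)]
    refine Real.rpow_le_rpow (norm_nonneg _) ?_ hp0.le
    have e : t₀ + ((j + 1 : ℕ) : ℝ) * h = t₀ + j * h + h := by push_cast; ring
    simp only [hz]
    rw [e]
    exact this
  have hsum := hineq.trans (Finset.sum_le_sum fun j _ => hstep j)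
  rw [← Finset.mul_sum] at hsum
  have hpos : 0 < ∑ j ∈ Finset.range (2 * m), ‖z j‖ ^ p := by
    refine Finset.sum_pos' (fun j _ => by positivity) ⟨0, by simpa using hm0, ?_⟩
    refine Real.rpow_pos_of_pos (norm_pos_iff.2 ?_) p
    simpa [hz, sub_eq_zero] using hne
  have h1 := le_of_mul_le_mul_right hsum hpos
  rw [Real.rpow_le_rpow_iff (by positivity) (by positivity) hp0] at h1
  have e : L * h * Real.exp (L * h) = T * L * Real.exp (L * T / 4 / m) / (4 * m) := by
    rw [hh, show (L : ℝ) * (T / (4 * m)) = L * T / 4 / m by field_simp]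
    field_simp
  rw [e, div_le_div_iff_of_pos_right (by positivity)] at h1
  linarith

theorem inv_wirtingerConst_le_period_mul {X : Type*} [NormedAddCommGroup X] [NormedSpace ℝ X]
    {p : ℝ} (hp : 1 < p) (hX : InheritsDiscreteWirtinger X p) {f : X → X} {x : ℝ → X} {T : ℝ}
    {L : ℝ≥0} (hf : LipschitzWith L f) (hx : IsNonconstantPeriodicSolution f x T) :
    (wirtingerConst p)⁻¹ ≤ T * L := by
  by_contra! hlt
  have hT := hx.period_pos
  have hper : ∀ k : ℕ, Function.Periodic x (T / 2 ^ k) := by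
    intro k
    induction k with
    | zero => simpa using hx.periodic
    | succ k ih =>
      have := periodic_half_of_mul_lt hp hX hf hx.hasDerivAt (by positivity) ih
        (lt_of_le_of_lt (by gcongr; exact div_le_self hT.le (one_le_pow₀ one_le_two)) hlt)
      rwa [div_div, ← pow_succ] at this
  -- the difference quotients along these periods vanish
  have hzero : ∀ t, f (x t) = 0 := by
    intro t
    have hτ : Filter.Tendsto (fun k : ℕ => T / 2 ^ k) Filter.atTop (nhdsWithin 0 {0}ᶜ) := by
      refine tendsto_nhdsWithin_iff.2 ⟨?_, .of_forall fun k => ?_⟩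
      · have := (tendsto_pow_atTop_nhds_zero_of_lt_one (r := (1 / 2 : ℝ)) (by norm_num)
          (by norm_num)).const_mul T
        simpa [div_eq_mul_inv] using this
      · have : T / 2 ^ k ≠ 0 := by positivity
        simpa using this
    have h1 := (hasDerivAt_iff_tendsto_slope_zero.1 (hx.hasDerivAt t)).comp hτ
    refine tendsto_nhds_unique h1 (tendsto_const_nhds.congr fun k => ?_)
    simp [hper k t]
  obtain ⟨s, t, hst⟩ := hx.nonconstant
  refine hst (is_const_of_deriv_eq_zero (𝕜 := ℝ) (fun t => (hx.hasDerivAt t).differentiableAt)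
    (fun t => ?_) s t)
  rw [(hx.hasDerivAt t).deriv, hzero]

theorem theorem4 (p : ℝ≥0∞) [Fact (1 ≤ p)] (hp_one : 1 < p) (hp_top : p ≠ ∞) :
    (∀ (n : ℕ)
      (f : PiLp p (fun _ : Fin n => ℝ) → PiLp p (fun _ : Fin n => ℝ))
      (x : ℝ → PiLp p (fun _ : Fin n => ℝ)) (T : ℝ) (L : ℝ≥0),
      LipschitzWith L f → IsNonconstantPeriodicSolution f x T →
        (wirtingerConst p.toReal)⁻¹ ≤ T * L ∧
        (1.43 ≤ p.toReal → p.toReal ≤ 3.35 → 6 < T * L)) ∧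
    (∀ (M : Type*) [MeasurableSpace M] (μ : Measure M)
      (f : Lp ℝ p μ → Lp ℝ p μ) (x : ℝ → Lp ℝ p μ) (T : ℝ) (L : ℝ≥0),
      LipschitzWith L f → IsNonconstantPeriodicSolution f x T →
        (wirtingerConst p.toReal)⁻¹ ≤ T * L ∧
        (1.43 ≤ p.toReal → p.toReal ≤ 3.35 → 6 < T * L)) ∧
    (1.43 ≤ p.toReal → p.toReal ≤ 3.35 → 6 < (wirtingerConst p.toReal)⁻¹) := by
  have hp : 1 < p.toReal := by
    rw [← ENNReal.toReal_one]
    exact (ENNReal.toReal_lt_toReal ENNReal.one_ne_top hp_top).2 hp_one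
  refine ⟨fun n f x T L hf hx => ?_, fun M _ μ f x T L hf hx => ?_, six_lt_inv_wirtingerConst⟩
  · have h := inv_wirtingerConst_le_period_mul hp
      (inheritsDiscreteWirtinger_piLp (zero_lt_one.trans hp)) hf hx
    exact ⟨h, fun h1 h2 => (six_lt_inv_wirtingerConst h1 h2).trans_le h⟩
  · have h := inv_wirtingerConst_le_period_mul hp (inheritsDiscreteWirtinger_lp hp_top) hf hx
    exact ⟨h, fun h1 h2 => (six_lt_inv_wirtingerConst h1 h2).trans_le h⟩
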